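/- Let $n\ge 1$ and let $X$ be a random vector in $\mathbb{R}^n$ whose distribution has a log-concave density $f$ with respect to Lebesgue measure; that is, $f\ge 0$ and $f(ax+by)\ge f(x)^a f(y)^b$ for all $x,y\in\mathbb{R}^n$ and all $a,b>0$ with $a+b=1$. Then $f\log f$ is integrable (with the convention $0\log 0=0$), so that the entropy $h(X)=-\int_{\mathbb{R}^n} f(x)\log f(x)\,dx$ is finite, and for every $0\le\varepsilon\le 2$, $$ \mathbf{P}\left\{\left|\frac{-\log f(X)}{n}-\frac{h(X)}{n}\right|\ge\varepsilon\right\}\le 4\,e^{-\varepsilon^2 n/16}. $$ -/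

import Mathlib

open MeasureTheory ProbabilityTheory

noncomputable section

/-- A function `f : E → ℝ` is log-concave: it is nonnegative and
`f (a x + b y) ≥ f x ^ a * f y ^ b` for all weights `a, b > 0` with `a + b = 1`.
(As `a, b > 0`, a factor with `f x = 0` makes the right-hand side `0`.) -/
def IsLogConcave {E : Type*} [AddCommGroup E] [Module ℝ E] (f : E → ℝ) : Prop :=
  (∀ x, 0 ≤ f x) ∧
    ∀ x y : E, ∀ a b : ℝ, 0 < a → 0 < b → a + b = 1 →
      f x ^ a * f y ^ b ≤ f (a • x + b • y)

/-- The random vector `X`, on the probability space `(Ω, P)`, has density `f` with respect to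
Lebesgue measure on `ℝⁿ`. -/
structure HasDensity {Ω : Type*} [MeasurableSpace Ω] (P : Measure Ω) {n : ℕ}
    (X : Ω → EuclideanSpace ℝ (Fin n)) (f : EuclideanSpace ℝ (Fin n) → ℝ) : Prop where
  /-- `f` is Lebesgue measurable -/
  aemeasurable_density : AEMeasurable f volume
  /-- `f` is nonnegative -/
  nonneg : ∀ x, 0 ≤ f x
  /-- `X` is a random vector whose distribution is `f(x) dx` -/
  hasLaw : HasLaw X (volume.withDensity fun x => ENNReal.ofReal (f x)) P

/-- The information content `-log f(x)` of a point `x` relative to the density `f`. -/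
def infoContent {n : ℕ} (f : EuclideanSpace ℝ (Fin n) → ℝ) (x : EuclideanSpace ℝ (Fin n)) : ℝ :=
  -Real.log (f x)

/-- The Shannon (differential) entropy `h(f) = -∫ f log f`, with `0 log 0 = 0`. -/
def entropy {n : ℕ} (f : EuclideanSpace ℝ (Fin n) → ℝ) : ℝ :=
  -∫ x, f x * Real.log (f x)

end

/-! For a log-concave density $f$ the function $\varphi(\alpha)=n\log\alpha+\log\int f^\alpha$ is
concave on $(0,\infty)$. Indeed $\alpha^n\int f^\alpha=\int f(x/\alpha)^\alpha\,dx$, the integrand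
is jointly log-concave in $(x,\alpha)$, and Prékopa–Leindler applies
(`IsLogConcave.lintegral_rpow_logConcave`).

Moreover $\varphi(1)=0$, and the tangent there has slope $n-h$, so
$\varphi(\alpha)\le(\alpha-1)(n-h)$. This is obtained without differentiating under the integral:
Jensen gives a lower bound for $\varphi$ with that tangent, and concavity does the rest
(`ConcaveOn.le_line_of_lower_bound`).

With $\alpha=1-t$, $\int f^\alpha$ is the moment generating function of $-\log f(X)$ at $t$, whence
$\mathbf E\,e^{t(-\log f(X)-h)}\le e^{n(-t-\log(1-t))}\le e^{nt^2/(1-t)}$ for $t<1$. Chernoff's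
bound at $t=\varepsilon/4$ and $t=-\varepsilon/2$ controls the two tails. -/

/-! ### The one-dimensional Prékopa–Leindler inequality -/

/-- The Brunn–Minkowski inequality on the real line, for nonempty compact sets. -/
theorem volume_add_volume_le_of_isCompact {K L C : Set ℝ} (hK : IsCompact K) (hL : IsCompact L)
    (hK0 : K.Nonempty) (hL0 : L.Nonempty) (h : ∀ x ∈ K, ∀ y ∈ L, x + y ∈ C) :
    volume K + volume L ≤ volume C := by
  obtain ⟨M, hM, hMK⟩ := hK.exists_isGreatest hK0
  obtain ⟨m, hm, hmL⟩ := hL.exists_isLeast hL0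
  -- The translates $K+m$ and $M+L$ both lie in $C$ and meet at most at $M+m$.
  set A : Set ℝ := (fun x => x + -m) ⁻¹' K with hA
  set B : Set ℝ := (fun x => -M + x) ⁻¹' L with hB
  have hvA : volume A = volume K := measure_preimage_add_right volume _ _
  have hvB : volume B = volume L := measure_preimage_add volume _ _
  have hBm : MeasurableSet B := hL.measurableSet.preimage (by fun_prop)
  have hd : AEDisjoint volume A B := by
    refine measure_mono_null (t := {M + m}) ?_ (by simp)
    rintro x ⟨hxA, hxB⟩
    have h1 := hMK hxA
    have h2 := hmL hxB
    simp only [Set.mem_singleton_iff]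
    linarith
  rw [← hvA, ← hvB, ← measure_union₀ hBm.nullMeasurableSet hd]
  refine measure_mono ?_
  rintro x (hx | hx)
  · have := h _ hx _ hm
    simpa using this
  · have := h _ hM _ hx
    simpa using this

/-- The Brunn–Minkowski inequality on the real line. -/
theorem volume_add_volume_le {A B C : Set ℝ} (hA : MeasurableSet A) (hB : MeasurableSet B)
    (hA0 : A.Nonempty) (hB0 : B.Nonempty) (h : ∀ x ∈ A, ∀ y ∈ B, x + y ∈ C) :
    volume A + volume B ≤ volume C := by
  obtain ⟨x₀, hx₀⟩ := hA0
  obtain ⟨y₀, hy₀⟩ := hB0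
  have key : ∀ K ⊆ A, IsCompact K → ∀ L ⊆ B, IsCompact L → volume K + volume L ≤ volume C := by
    intro K hKA hK L hLB hL
    -- Adjoining $x_0$ and $y_0$ makes the compact sets nonempty without leaving $A$ and $B$.
    refine le_trans (add_le_add (measure_mono (Set.subset_insert x₀ K))
      (measure_mono (Set.subset_insert y₀ L)))
      (volume_add_volume_le_of_isCompact (hK.insert x₀) (hL.insert y₀) (Set.insert_nonempty _ _)
        (Set.insert_nonempty _ _) fun x hx y hy => h x ?_ y ?_)
    · exact Set.insert_subset hx₀ hKA hx
    · exact Set.insert_subset hy₀ hLB hy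
  have hsup : ∀ {D : Set ℝ}, MeasurableSet D →
      volume D = ⨆ (K : Set ℝ) (_ : K ⊆ D ∧ IsCompact K), volume K := by
    intro D hD
    rw [hD.measure_eq_iSup_isCompact]
    simp only [iSup_and]
  rw [hsup hA, hsup hB]
  refine ENNReal.biSup_add_biSup_le' ⟨∅, by simp⟩ ⟨∅, by simp⟩ ?_
  rintro K ⟨hKA, hK⟩ L ⟨hLB, hL⟩
  exact key K hKA hK L hLB hL

theorem volume_smul_add_volume_smul_le {A B C : Set ℝ} (hA : MeasurableSet A)
    (hB : MeasurableSet B) (hA0 : A.Nonempty) (hB0 : B.Nonempty) {a b : ℝ} (ha : 0 < a)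
    (hb : 0 < b) (h : ∀ x ∈ A, ∀ y ∈ B, a * x + b * y ∈ C) :
    ENNReal.ofReal a * volume A + ENNReal.ofReal b * volume B ≤ volume C := by
  have hm : ∀ {c : ℝ}, 0 < c → ∀ D : Set ℝ,
      ENNReal.ofReal c * volume D = volume ((fun x => c⁻¹ * x) ⁻¹' D) := by
    intro c hc D
    rw [Real.volume_preimage_mul_left (inv_ne_zero hc.ne'), inv_inv, abs_of_pos hc]
  rw [hm ha, hm hb]
  refine volume_add_volume_le (hA.preimage (by fun_prop)) (hB.preimage (by fun_prop)) ?_ ?_ ?_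
  · obtain ⟨x, hx⟩ := hA0
    exact ⟨a * x, by simpa [ha.ne'] using hx⟩
  · obtain ⟨x, hx⟩ := hB0
    exact ⟨b * x, by simpa [hb.ne'] using hx⟩
  · intro x hx y hy
    have := h _ hx _ hy
    rwa [mul_inv_cancel_left₀ ha.ne', mul_inv_cancel_left₀ hb.ne'] at this

theorem ENNReal.rpow_mul_rpow_le_add (u v : ENNReal) {a b : ℝ} (ha : 0 < a) (hb : 0 < b)
    (hab : a + b = 1) :
    u ^ a * v ^ b ≤ ENNReal.ofReal a * u + ENNReal.ofReal b * v := by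
  have ha' : ENNReal.ofReal a ≠ 0 := by simpa using ha
  have hb' : ENNReal.ofReal b ≠ 0 := by simpa using hb
  rcases eq_or_ne u ⊤ with rfl | hu
  · simp [ENNReal.mul_top ha']
  rcases eq_or_ne v ⊤ with rfl | hv
  · simp [ENNReal.mul_top hb']
  lift u to NNReal using hu
  lift v to NNReal using hv
  have := NNReal.geom_mean_le_arith_mean2_weighted a.toNNReal b.toNNReal u v
    (by rw [← Real.toNNReal_add ha.le hb.le, hab, Real.toNNReal_one])
  rw [Real.coe_toNNReal _ ha.le, Real.coe_toNNReal _ hb.le] at this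
  rw [← ENNReal.coe_rpow_of_nonneg _ ha.le, ← ENNReal.coe_rpow_of_nonneg _ hb.le]
  simpa only [ENNReal.ofReal] using (by exact_mod_cast this)

/-- The additive form of the one-dimensional Prékopa–Leindler inequality, for functions whose
supremum is `1`. -/
theorem lintegral_add_lintegral_le_of_sup_eq_one {φ ψ χ : ℝ → ℝ} (hφ : Measurable φ)
    (hψ : Measurable ψ) (hχ : Measurable χ) (hφ0 : ∀ x, 0 ≤ φ x) (hψ0 : ∀ x, 0 ≤ ψ x)
    (hχ0 : ∀ x, 0 ≤ χ x) (hφ1 : ∀ x, φ x ≤ 1) (hψ1 : ∀ x, ψ x ≤ 1)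
    (hφs : ∀ t < 1, ∃ x, t < φ x) (hψs : ∀ t < 1, ∃ x, t < ψ x)
    {a b : ℝ} (ha : 0 < a) (hb : 0 < b) (hab : a + b = 1)
    (h : ∀ x y, φ x ^ a * ψ y ^ b ≤ χ (a * x + b * y)) :
    ENNReal.ofReal a * (∫⁻ x, ENNReal.ofReal (φ x)) +
        ENNReal.ofReal b * (∫⁻ x, ENNReal.ofReal (ψ x)) ≤
      ∫⁻ x, ENNReal.ofReal (χ x) := by
  rw [lintegral_eq_lintegral_meas_lt volume (.of_forall hφ0) hφ.aemeasurable,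
    lintegral_eq_lintegral_meas_lt volume (.of_forall hψ0) hψ.aemeasurable,
    lintegral_eq_lintegral_meas_lt volume (.of_forall hχ0) hχ.aemeasurable]
  have hm : ∀ f : ℝ → ℝ, Measurable fun t : ℝ => volume {x | t < f x} := fun f =>
    Antitone.measurable fun s t hst => measure_mono fun x hx => lt_of_le_of_lt hst hx
  rw [← lintegral_const_mul _ (hm φ), ← lintegral_const_mul _ (hm ψ),
    ← lintegral_add_left ((hm φ).const_mul _)]
  refine setLIntegral_mono (hm χ) fun t ht => ?_
  -- After the layer-cake formula, levels are compared one by one. Below $1$ both superlevel sets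
  -- are nonempty, as Brunn–Minkowski requires; from $1$ on both are empty.
  rcases lt_or_ge t 1 with ht1 | ht1
  · refine volume_smul_add_volume_smul_le (measurableSet_lt measurable_const hφ)
      (measurableSet_lt measurable_const hψ) (hφs t ht1) (hψs t ht1) ha hb ?_
    intro x hx y hy
    refine lt_of_lt_of_le ?_ (h x y)
    have ht0 : (0 : ℝ) < t := ht
    calc t = t ^ a * t ^ b := by rw [← Real.rpow_add ht0, hab, Real.rpow_one]
      _ < φ x ^ a * ψ y ^ b := by
        have h1 : t ^ a < φ x ^ a := Real.rpow_lt_rpow ht0.le hx ha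
        have h2 : t ^ b < ψ y ^ b := Real.rpow_lt_rpow ht0.le hy hb
        exact mul_lt_mul'' h1 h2 (by positivity) (by positivity)
  · have h1 : {x | t < φ x} = ∅ := by
      ext x; simpa using (hφ1 x).trans ht1
    have h2 : {x | t < ψ x} = ∅ := by
      ext x; simpa using (hψ1 x).trans ht1
    simp [h1, h2]

/-- The one-dimensional Prékopa–Leindler inequality for bounded functions. -/
theorem prekopaLeindler_real_of_bounded {f g h : ℝ → ENNReal} (hf : Measurable f)
    (hg : Measurable g) (hh : Measurable h) {M N : ENNReal} (hM : M ≠ ⊤) (hN : N ≠ ⊤)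
    (hfM : ∀ x, f x ≤ M) (hgN : ∀ x, g x ≤ N) {a b : ℝ} (ha : 0 < a) (hb : 0 < b)
    (hab : a + b = 1) (H : ∀ x y, f x ^ a * g y ^ b ≤ h (a * x + b * y)) :
    (∫⁻ x, f x) ^ a * (∫⁻ x, g x) ^ b ≤ ∫⁻ x, h x := by
  set S := ⨆ x, f x with hS
  set T := ⨆ x, g x with hT
  have hfS : ∀ x, f x ≤ S := le_iSup f
  have hgT : ∀ x, g x ≤ T := le_iSup g
  have hSt : S ≠ ⊤ := ne_top_of_le_ne_top hM (iSup_le hfM)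
  have hTt : T ≠ ⊤ := ne_top_of_le_ne_top hN (iSup_le hgN)
  rcases eq_or_ne S 0 with hS0 | hS0
  · have : ∀ x, f x = 0 := fun x => le_antisymm (hS0 ▸ hfS x) (zero_le)
    simp [this, ha]
  rcases eq_or_ne T 0 with hT0 | hT0
  · have : ∀ x, g x = 0 := fun x => le_antisymm (hT0 ▸ hgT x) (zero_le)
    simp [this, hb]
  set c := S ^ a * T ^ b with hc
  have hSa : S ^ a ≠ 0 := by simp [ENNReal.rpow_eq_zero_iff, hS0, hSt]
  have hTb : T ^ b ≠ 0 := by simp [ENNReal.rpow_eq_zero_iff, hT0, hTt]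
  have hSa' : S ^ a ≠ ⊤ := ENNReal.rpow_ne_top_of_nonneg ha.le hSt
  have hTb' : T ^ b ≠ ⊤ := ENNReal.rpow_ne_top_of_nonneg hb.le hTt
  have hc0 : c ≠ 0 := mul_ne_zero hSa hTb
  have hct : c ≠ ⊤ := ENNReal.mul_ne_top hSa' hTb'
  have hdiv : ∀ (k : ℝ → ENNReal) (R : ENNReal), (∀ x, k x ≤ R) → ∀ x, k x / R ≤ 1 :=
    fun k R hk x => ENNReal.div_le_of_le_mul (by simpa using hk x)
  have hsup : ∀ (k : ℝ → ENNReal), (⨆ x, k x) ≠ 0 → (⨆ x, k x) ≠ ⊤ →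
      ∀ t < (1 : ℝ), ∃ x, t < (k x / ⨆ x, k x).toReal := by
    intro k h0 ht t ht1
    rcases lt_or_ge t 0 with ht0 | ht0
    · exact ⟨0, ht0.trans_le ENNReal.toReal_nonneg⟩
    have hlt : ENNReal.ofReal t * (⨆ x, k x) < ⨆ x, k x := by
      conv_rhs => rw [← one_mul (⨆ x, k x)]
      refine (ENNReal.mul_lt_mul_iff_left h0 ht).2 ?_
      rwa [← ENNReal.ofReal_one, ENNReal.ofReal_lt_ofReal_iff one_pos]
    obtain ⟨x, hx⟩ := lt_iSup_iff.1 hlt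
    refine ⟨x, (ENNReal.ofReal_lt_iff_lt_toReal ht0 ?_).1
      ((ENNReal.lt_div_iff_mul_lt (Or.inl h0) (Or.inl ht)).2 hx)⟩
    exact ne_top_of_le_ne_top ENNReal.one_ne_top (hdiv k _ (le_iSup k) x)
  -- Dividing by the suprema makes both equal to $1$. Capping $h/c$ at $1$ keeps `toReal` from
  -- sending $\infty$ to $0$, and costs nothing since the left-hand product is at most $1$.
  have key := lintegral_add_lintegral_le_of_sup_eq_one (φ := fun x => (f x / S).toReal)
    (ψ := fun x => (g x / T).toReal) (χ := fun x => (min (h x / c) 1).toReal)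
    (hf.div_const S).ennreal_toReal (hg.div_const T).ennreal_toReal
    ((hh.div_const c).min measurable_const).ennreal_toReal
    (fun _ => ENNReal.toReal_nonneg) (fun _ => ENNReal.toReal_nonneg)
    (fun _ => ENNReal.toReal_nonneg)
    (fun x => ENNReal.toReal_le_of_le_ofReal zero_le_one (by simpa using hdiv f S hfS x))
    (fun x => ENNReal.toReal_le_of_le_ofReal zero_le_one (by simpa using hdiv g T hgT x))
    (hsup f hS0 hSt) (hsup g hT0 hTt) ha hb hab ?_
  · have e1 : ∀ x, ENNReal.ofReal (f x / S).toReal = f x / S := fun x =>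
      ENNReal.ofReal_toReal (ne_top_of_le_ne_top ENNReal.one_ne_top (hdiv f S hfS x))
    have e2 : ∀ x, ENNReal.ofReal (g x / T).toReal = g x / T := fun x =>
      ENNReal.ofReal_toReal (ne_top_of_le_ne_top ENNReal.one_ne_top (hdiv g T hgT x))
    simp only [e1, e2] at key
    -- Weighted AM–GM turns the additive inequality into the multiplicative one.
    have h3 := (ENNReal.rpow_mul_rpow_le_add (∫⁻ x, f x / S) (∫⁻ x, g x / T) ha hb hab).trans key
    have h4 : ∫⁻ x, ENNReal.ofReal (min (h x / c) 1).toReal ≤ (∫⁻ x, h x) / c := by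
      rw [div_eq_mul_inv, ← lintegral_mul_const _ hh]
      exact lintegral_mono fun x => ENNReal.ofReal_toReal_le.trans (min_le_left _ _)
    have h5 := h3.trans h4
    simp only [div_eq_mul_inv] at h5
    rw [lintegral_mul_const _ hf, lintegral_mul_const _ hg, ← div_eq_mul_inv, ← div_eq_mul_inv,
      ← div_eq_mul_inv, ENNReal.div_rpow_of_nonneg _ _ ha.le, ENNReal.div_rpow_of_nonneg _ _ hb.le,
      ← ENNReal.mul_div_mul_comm (Or.inl hSa) (Or.inl hSa')] at h5
    simpa [ENNReal.div_mul_cancel hc0 hct] using (ENNReal.div_le_iff hc0 hct).1 h5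
  · intro x y
    rw [ENNReal.toReal_rpow, ENNReal.toReal_rpow, ← ENNReal.toReal_mul]
    refine ENNReal.toReal_mono (by simp) (le_min ?_ ?_)
    · rw [ENNReal.div_rpow_of_nonneg _ _ ha.le, ENNReal.div_rpow_of_nonneg _ _ hb.le,
        ← ENNReal.mul_div_mul_comm (Or.inl hSa) (Or.inl hSa')]
      exact ENNReal.div_le_div_right (H x y) c
    · exact mul_le_one' (ENNReal.rpow_le_one (hdiv f S hfS x) ha.le)
        (ENNReal.rpow_le_one (hdiv g T hgT y) hb.le)

/-- The one-dimensional Prékopa–Leindler inequality. -/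
theorem prekopaLeindler_real {f g h : ℝ → ENNReal} (hf : Measurable f)
    (hg : Measurable g) (hh : Measurable h) {a b : ℝ} (ha : 0 < a) (hb : 0 < b)
    (hab : a + b = 1) (H : ∀ x y, f x ^ a * g y ^ b ≤ h (a * x + b * y)) :
    (∫⁻ x, f x) ^ a * (∫⁻ x, g x) ^ b ≤ ∫⁻ x, h x := by
  have hsup : ∀ k : ℝ → ENNReal, Measurable k → ∀ {s : ℝ}, 0 < s →
      (∫⁻ x, k x) ^ s = ⨆ n : ℕ, (∫⁻ x, min (k x) n) ^ s := by
    intro k hk s hs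
    have h1 : ∀ x, k x = ⨆ n : ℕ, min (k x) n := by
      intro x
      rw [← inf_iSup_eq, ENNReal.iSup_natCast, inf_top_eq]
    have h2 : ∫⁻ x, k x = ⨆ n : ℕ, ∫⁻ x, min (k x) n := by
      rw [← lintegral_iSup (fun n => hk.min measurable_const)
        (fun m n hmn x => min_le_min_left _ (by exact_mod_cast hmn))]
      exact lintegral_congr h1
    rw [h2]
    exact (ENNReal.orderIsoRpow s hs).map_iSup _
  rw [hsup f hf ha, hsup g hg hb]
  simp only [ENNReal.iSup_mul, ENNReal.mul_iSup, iSup_le_iff]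
  intro n m
  refine prekopaLeindler_real_of_bounded (hf.min measurable_const) (hg.min measurable_const) hh
    (ENNReal.natCast_ne_top m) (ENNReal.natCast_ne_top n) (fun x => min_le_right _ _)
    (fun x => min_le_right _ _) ha hb hab fun x y => le_trans ?_ (H x y)
  exact mul_le_mul' (ENNReal.rpow_le_rpow (min_le_left _ _) ha.le)
    (ENNReal.rpow_le_rpow (min_le_left _ _) hb.le)

/-! ### Prékopa–Leindler in dimension $n$ -/

/-- The **Prékopa–Leindler inequality** on `Fin n → ℝ`. -/
theorem prekopaLeindler_pi (n : ℕ) {f g h : (Fin n → ℝ) → ENNReal} (hf : Measurable f)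
    (hg : Measurable g) (hh : Measurable h) {a b : ℝ} (ha : 0 < a) (hb : 0 < b)
    (hab : a + b = 1) (H : ∀ x y, f x ^ a * g y ^ b ≤ h (a • x + b • y)) :
    (∫⁻ x, f x) ^ a * (∫⁻ x, g x) ^ b ≤ ∫⁻ x, h x := by
  induction n with
  | zero =>
    have hv : ∀ k : (Fin 0 → ℝ) → ENNReal, ∫⁻ x, k x = k default := by
      intro k
      rw [lintegral_unique, Measure.volume_pi_eq_dirac default, measure_univ, mul_one]
      exact congrArg k (Subsingleton.elim _ _)
    rw [hv, hv, hv]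
    convert H default default
  | succ n ih =>
    set e := MeasurableEquiv.piFinSuccAbove (fun _ : Fin (n + 1) => ℝ) 0 with he
    have hmp : MeasurePreserving e.symm :=
      (volume_preserving_piFinSuccAbove (fun _ : Fin (n + 1) => ℝ) 0).symm e
    have hint : ∀ k : (Fin (n + 1) → ℝ) → ENNReal, Measurable k →
        ∫⁻ x, k x = ∫⁻ t : ℝ, ∫⁻ x : Fin n → ℝ, k (e.symm (t, x)) := by
      intro k hk
      rw [← hmp.lintegral_comp hk]
      exact lintegral_prod _ (hk.comp e.symm.measurable).aemeasurable
    have hmeas : ∀ k : (Fin (n + 1) → ℝ) → ENNReal, Measurable k →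
        Measurable fun t : ℝ => ∫⁻ x : Fin n → ℝ, k (e.symm (t, x)) := fun k hk =>
      Measurable.lintegral_prod_right' (hk.comp e.symm.measurable)
    have hsec : ∀ k : (Fin (n + 1) → ℝ) → ENNReal, Measurable k → ∀ t : ℝ,
        Measurable fun x : Fin n → ℝ => k (e.symm (t, x)) := fun k hk t =>
      (hk.comp e.symm.measurable).comp measurable_prodMk_left
    rw [hint f hf, hint g hg, hint h hh]
    -- By induction, the integrals over the slices with fixed coordinate $0$ satisfy the
    -- one-dimensional hypothesis.
    refine prekopaLeindler_real (hmeas f hf) (hmeas g hg) (hmeas h hh) ha hb hab fun s t => ?_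
    refine ih (hsec f hf s) (hsec g hg t) (hsec h hh _) fun x y => ?_
    convert H (e.symm (s, x)) (e.symm (t, y)) using 2
    ext i
    refine Fin.cases ?_ (fun j => ?_) i <;>
      simp [he, MeasurableEquiv.piFinSuccAbove, Fin.insertNthEquiv]

/-- The **Prékopa–Leindler inequality** on Euclidean space. -/
theorem prekopaLeindler {n : ℕ} {f g h : EuclideanSpace ℝ (Fin n) → ENNReal} (hf : Measurable f)
    (hg : Measurable g) (hh : Measurable h) {a b : ℝ} (ha : 0 < a) (hb : 0 < b)
    (hab : a + b = 1) (H : ∀ x y, f x ^ a * g y ^ b ≤ h (a • x + b • y)) :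
    (∫⁻ x, f x) ^ a * (∫⁻ x, g x) ^ b ≤ ∫⁻ x, h x := by
  have hmp := PiLp.volume_preserving_toLp (Fin n)
  rw [← hmp.lintegral_comp hf, ← hmp.lintegral_comp hg, ← hmp.lintegral_comp hh]
  refine prekopaLeindler_pi n (hf.comp hmp.measurable) (hg.comp hmp.measurable)
    (hh.comp hmp.measurable) ha hb hab fun x y => ?_
  simpa using H (WithLp.toLp 2 x) (WithLp.toLp 2 y)

/-! ### Log-concave functions and their perspectives -/

namespace IsLogConcave

theorem convex_setOf_pos {E : Type*} [AddCommGroup E] [Module ℝ E] {f : E → ℝ}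
    (hf : IsLogConcave f) : Convex ℝ {x | 0 < f x} := by
  refine convex_iff_forall_pos.2 fun x hx y hy a b ha hb hab => ?_
  exact lt_of_lt_of_le (mul_pos (Real.rpow_pos_of_pos hx a) (Real.rpow_pos_of_pos hy b))
    (hf.2 x y a b ha hb hab)

theorem concaveOn_log {E : Type*} [AddCommGroup E] [Module ℝ E] {f : E → ℝ}
    (hf : IsLogConcave f) : ConcaveOn ℝ {x | 0 < f x} fun x => Real.log (f x) := by
  refine concaveOn_iff_forall_pos.2 ⟨hf.convex_setOf_pos, fun x hx y hy a b ha hb hab => ?_⟩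
  have hxa := Real.rpow_pos_of_pos (show 0 < f x from hx) a
  have hyb := Real.rpow_pos_of_pos (show 0 < f y from hy) b
  have := Real.log_le_log (mul_pos hxa hyb) (hf.2 x y a b ha hb hab)
  rwa [Real.log_mul hxa.ne' hyb.ne', Real.log_rpow hx, Real.log_rpow hy] at this

/-- A log-concave function agrees almost everywhere with a Borel measurable log-concave
function. -/
theorem exists_measurable_ae_eq {n : ℕ} {f : EuclideanSpace ℝ (Fin n) → ℝ} (hf : IsLogConcave f) :
    ∃ g : EuclideanSpace ℝ (Fin n) → ℝ, Measurable g ∧ IsLogConcave g ∧ f =ᵐ[volume] g := by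
  classical
  set S := {x | 0 < f x} with hS
  have hSc : Convex ℝ S := hf.convex_setOf_pos
  -- On the interior of the support $f$ is the exponential of a continuous concave function; the
  -- frontier of a convex set is null.
  refine ⟨(interior S).indicator f, ?_, ⟨?_, ?_⟩, ?_⟩
  · have hcont : ContinuousOn f (interior S) := by
      refine (Real.continuous_exp.comp_continuousOn hf.concaveOn_log.continuousOn_interior).congr ?_
      intro x hx
      have hxS : x ∈ S := interior_subset hx
      exact (Real.exp_log hxS).symm
    rw [← Set.piecewise_eq_indicator]
    exact hcont.measurable_piecewise continuousOn_const isOpen_interior.measurableSet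
  · exact fun x => Set.indicator_nonneg (fun x _ => hf.1 x) x
  · intro x y a b ha hb hab
    have h0 : 0 ≤ (interior S).indicator f (a • x + b • y) :=
      Set.indicator_nonneg (fun x _ => hf.1 x) _
    by_cases hx : x ∈ interior S
    · by_cases hy : y ∈ interior S
      · rw [Set.indicator_of_mem hx, Set.indicator_of_mem hy,
          Set.indicator_of_mem (hSc.interior hx hy ha.le hb.le hab)]
        exact hf.2 x y a b ha hb hab
      · rwa [Set.indicator_of_notMem hy, Real.zero_rpow hb.ne', mul_zero]
    · rwa [Set.indicator_of_notMem hx, Real.zero_rpow ha.ne', zero_mul]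
  · have hfr : ∀ᵐ x, x ∉ frontier S := measure_eq_zero_iff_ae_notMem.1 (hSc.addHaar_frontier volume)
    filter_upwards [hfr] with x hx
    by_cases hxi : x ∈ interior S
    · rw [Set.indicator_of_mem hxi]
    · rw [Set.indicator_of_notMem hxi]
      have : x ∉ S := fun hxS => hx ⟨subset_closure hxS, hxi⟩
      exact le_antisymm (not_lt.1 this) (hf.1 x)

/-- The perspective inequality: `(x, α) ↦ f (x / α) ^ α` is jointly log-concave. -/
theorem rpow_mul_rpow_le_perspective {E : Type*} [AddCommGroup E] [Module ℝ E] {f : E → ℝ}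
    (hf : IsLogConcave f) {α β a b : ℝ} (hα : 0 < α) (hβ : 0 < β) (ha : 0 < a) (hb : 0 < b)
    (x y : E) :
    (f (α⁻¹ • x) ^ α) ^ a * (f (β⁻¹ • y) ^ β) ^ b ≤
      f ((a * α + b * β)⁻¹ • (a • x + b • y)) ^ (a * α + b * β) := by
  set γ := a * α + b * β with hγ
  have hγ0 : 0 < γ := by positivity
  -- These weights recombine $x/\alpha$ and $y/\beta$ into $(ax+by)/\gamma$; raising to the power
  -- $\gamma$ clears their denominators.
  have h := hf.2 (α⁻¹ • x) (β⁻¹ • y) (a * α / γ) (b * β / γ) (by positivity) (by positivity)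
    (by rw [← add_div, div_self hγ0.ne'])
  have e : (a * α / γ) • α⁻¹ • x + (b * β / γ) • β⁻¹ • y = γ⁻¹ • (a • x + b • y) := by
    simp only [smul_smul, smul_add]
    congr 2 <;> field_simp
  rw [e] at h
  have h1 := hf.1 (α⁻¹ • x)
  have h2 := hf.1 (β⁻¹ • y)
  refine le_trans (le_of_eq ?_) (Real.rpow_le_rpow (by positivity) h hγ0.le)
  rw [Real.mul_rpow (by positivity) (by positivity), ← Real.rpow_mul h1, ← Real.rpow_mul h2,
    ← Real.rpow_mul h1, ← Real.rpow_mul h2, div_mul_cancel₀ _ hγ0.ne', div_mul_cancel₀ _ hγ0.ne',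
    mul_comm α, mul_comm β]

end IsLogConcave

theorem lintegral_comp_inv_smul {n : ℕ} {F : EuclideanSpace ℝ (Fin n) → ENNReal}
    (hF : Measurable F) {r : ℝ} (hr : 0 < r) :
    ∫⁻ x, F (r⁻¹ • x) = ENNReal.ofReal (r ^ n) * ∫⁻ x, F x := by
  rw [← lintegral_map hF (measurable_const_smul r⁻¹),
    Measure.map_addHaar_smul volume (inv_ne_zero hr.ne'), lintegral_smul_measure]
  simp [abs_of_pos hr]

namespace IsLogConcave

/-- For a log-concave function `f` on `ℝⁿ`, the function `α ↦ αⁿ ∫ f ^ α` is log-concave on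
`(0, ∞)`. -/
theorem lintegral_rpow_logConcave {n : ℕ} {f : EuclideanSpace ℝ (Fin n) → ℝ}
    (hf : IsLogConcave f) {α β a b : ℝ} (hα : 0 < α) (hβ : 0 < β) (ha : 0 < a) (hb : 0 < b)
    (hab : a + b = 1) :
    (ENNReal.ofReal (α ^ n) * ∫⁻ x, ENNReal.ofReal (f x ^ α)) ^ a *
      (ENNReal.ofReal (β ^ n) * ∫⁻ x, ENNReal.ofReal (f x ^ β)) ^ b ≤
      ENNReal.ofReal ((a * α + b * β) ^ n) * ∫⁻ x, ENNReal.ofReal (f x ^ (a * α + b * β)) := by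
  obtain ⟨g, hgm, hg, hfg⟩ := hf.exists_measurable_ae_eq
  have hJ : ∀ γ : ℝ, ∫⁻ x, ENNReal.ofReal (f x ^ γ) = ∫⁻ x, ENNReal.ofReal (g x ^ γ) := fun γ =>
    lintegral_congr_ae (hfg.mono fun x hx => by simp only [hx])
  have hm : ∀ γ : ℝ, Measurable fun x => ENNReal.ofReal (g x ^ γ) := fun γ =>
    (hgm.pow_const γ).ennreal_ofReal
  have hγ : 0 < a * α + b * β := by positivity
  -- The factor $\alpha^n$ is the Jacobian of $x\mapsto x/\alpha$, which leaves integrals of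
  -- perspectives.
  rw [hJ, hJ, hJ, ← lintegral_comp_inv_smul (hm α) hα, ← lintegral_comp_inv_smul (hm β) hβ,
    ← lintegral_comp_inv_smul (hm _) hγ]
  refine prekopaLeindler ((hm α).comp (measurable_const_smul _))
    ((hm β).comp (measurable_const_smul _)) ((hm _).comp (measurable_const_smul _)) ha hb hab
    fun x y => ?_
  have h1 : 0 ≤ g (α⁻¹ • x) ^ α := Real.rpow_nonneg (hg.1 _) _
  have h2 : 0 ≤ g (β⁻¹ • y) ^ β := Real.rpow_nonneg (hg.1 _) _
  simp only [Function.comp_apply]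
  rw [ENNReal.ofReal_rpow_of_nonneg h1 ha.le, ENNReal.ofReal_rpow_of_nonneg h2 hb.le,
    ← ENNReal.ofReal_mul (Real.rpow_nonneg h1 _)]
  exact ENNReal.ofReal_le_ofReal (hg.rpow_mul_rpow_le_perspective hα hβ ha hb x y)

end IsLogConcave

/-! ### Power moments and entropy -/

/-- If a concave function on `(0, ∞)` vanishes at `1` and is bounded below by
`γ ↦ (γ - 1) (E + c / γ)`, then it lies below the line of slope `E + c` through `(1, 0)`. -/
theorem ConcaveOn.le_line_of_lower_bound {φ : ℝ → ℝ} {E c : ℝ}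
    (hφ : ConcaveOn ℝ (Set.Ioi 0) φ) (h1 : φ 1 = 0)
    (hl : ∀ γ, 0 < γ → (γ - 1) * (E + c / γ) ≤ φ γ) {α : ℝ} (hα : 0 < α) :
    φ α ≤ (α - 1) * (E + c) := by
  have hcont : ContinuousAt (fun γ : ℝ => (α - 1) * (E + c / γ)) 1 := by
    fun_prop (disch := norm_num)
  have hval : (α - 1) * (E + c) = (fun γ : ℝ => (α - 1) * (E + c / γ)) 1 := by simp
  rw [hval]
  rcases lt_trichotomy α 1 with hlt | rfl | hgt
  -- The chord over $[\alpha,1]$ is at least as steep as the one over $[1,\gamma]$, whose slope is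
  -- at least $E+c/\gamma$; let $\gamma\downarrow1$. The case $\alpha>1$ is the mirror image.
  · refine ge_of_tendsto (hcont.tendsto.mono_left (nhdsWithin_le_nhds (s := Set.Ioi 1))) ?_
    filter_upwards [self_mem_nhdsWithin] with γ (hγ : 1 < γ)
    have h := hφ.slope_anti_adjacent (show α ∈ Set.Ioi (0 : ℝ) from hα)
      (show γ ∈ Set.Ioi (0 : ℝ) from zero_lt_one.trans hγ) hlt hγ
    rw [h1, sub_zero, zero_sub] at h
    have hγ' : 0 < γ - 1 := sub_pos.2 hγ
    have h2 : E + c / γ ≤ φ γ / (γ - 1) := by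
      rw [le_div_iff₀ hγ', mul_comm]
      exact hl γ (zero_lt_one.trans hγ)
    have h3 := h2.trans h
    rw [le_div_iff₀ (sub_pos.2 hlt)] at h3
    linarith
  · simp [h1]
  · refine ge_of_tendsto (hcont.tendsto.mono_left (nhdsWithin_le_nhds (s := Set.Iio 1))) ?_
    filter_upwards [self_mem_nhdsWithin, nhdsWithin_le_nhds (Ioi_mem_nhds one_pos)]
      with γ (hγ : γ < 1) (hγ0 : 0 < γ)
    have h := hφ.slope_anti_adjacent (show γ ∈ Set.Ioi (0 : ℝ) from hγ0)
      (show α ∈ Set.Ioi (0 : ℝ) from hα) hγ hgt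
    rw [h1, sub_zero, zero_sub] at h
    have h2 : -φ γ / (1 - γ) ≤ E + c / γ := by
      rw [div_le_iff₀ (sub_pos.2 hγ)]
      have := hl γ hγ0
      linarith
    have h3 := h.trans h2
    rw [div_le_iff₀ (sub_pos.2 hgt)] at h3
    linarith

section

variable {n : ℕ} {f : EuclideanSpace ℝ (Fin n) → ℝ}

theorem lintegral_rpow_ne_zero (hm : AEMeasurable f volume) (h0 : ∀ x, 0 ≤ f x)
    (h1 : ∫⁻ x, ENNReal.ofReal (f x) = 1) (α : ℝ) :
    ∫⁻ x, ENNReal.ofReal (f x ^ α) ≠ 0 := by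
  intro h
  rw [lintegral_eq_zero_iff' (hm.pow_const α).ennreal_ofReal] at h
  have : ∫⁻ x, ENNReal.ofReal (f x) = 0 := by
    rw [lintegral_eq_zero_iff' hm.ennreal_ofReal]
    filter_upwards [h] with x hx
    have hx' : f x ^ α ≤ 0 := by simpa using hx
    have : f x = 0 := by
      by_contra hne
      exact absurd hx' (not_le.2 (Real.rpow_pos_of_pos (lt_of_le_of_ne (h0 x) (Ne.symm hne)) α))
    simp [this]
  simp [this] at h1

/-- Choose $\beta$ so that $1$ lies strictly between $\alpha$ and $\beta$. Log-concavity of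
$\alpha^n\int f^\alpha$ would then bound $\infty$ times a nonzero quantity by $\int f=1$. -/
theorem IsLogConcave.lintegral_rpow_ne_top (hf : IsLogConcave f) (hm : AEMeasurable f volume)
    (h1 : ∫⁻ x, ENNReal.ofReal (f x) = 1) {α : ℝ} (hα : 0 < α) :
    ∫⁻ x, ENNReal.ofReal (f x ^ α) ≠ ⊤ := by
  intro htop
  have key : ∀ β a b : ℝ, 0 < β → 0 < a → 0 < b → a + b = 1 → a * α + b * β = 1 → False := by
    intro β a b hβ ha hb hab hsum
    have h := hf.lintegral_rpow_logConcave hα hβ ha hb hab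
    have hαn : ENNReal.ofReal (α ^ n) ≠ 0 := by
      simpa using pow_pos hα n
    have hβn : ENNReal.ofReal (β ^ n) ≠ 0 := by
      simpa using pow_pos hβ n
    have hne : (ENNReal.ofReal (β ^ n) * ∫⁻ x, ENNReal.ofReal (f x ^ β)) ^ b ≠ 0 := by
      rw [Ne, ENNReal.rpow_eq_zero_iff_of_pos hb]
      exact mul_ne_zero hβn (lintegral_rpow_ne_zero hm hf.1 h1 β)
    simp only [hsum, Real.rpow_one, h1] at h
    rw [htop, ENNReal.mul_top hαn, ENNReal.top_rpow_of_pos ha, ENNReal.top_mul hne] at h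
    simp at h
  rcases lt_trichotomy α 1 with hlt | rfl | hgt
  · have h2 : 0 < 2 - α := by linarith
    have h3 : 0 < 1 - α := by linarith
    refine key 2 (1 / (2 - α)) ((1 - α) / (2 - α)) two_pos (by positivity) (by positivity) ?_ ?_
    · field_simp; ring
    · field_simp; ring
  · simp [h1] at htop
  · have h2 : 0 < 2 * α - 1 := by linarith
    have h3 : 0 < α - 1 := by linarith
    refine key (1 / 2) (1 / (2 * α - 1)) (2 * (α - 1) / (2 * α - 1)) (by norm_num) (by positivity)
      (by positivity) ?_ ?_
    · field_simp; ring
    · field_simp; ring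

theorem IsLogConcave.integrable_rpow (hf : IsLogConcave f) (hm : AEMeasurable f volume)
    (h1 : ∫⁻ x, ENNReal.ofReal (f x) = 1) {α : ℝ} (hα : 0 < α) :
    Integrable fun x => f x ^ α := by
  refine (lintegral_ofReal_ne_top_iff_integrable (hm.pow_const α).aestronglyMeasurable
    (.of_forall fun x => Real.rpow_nonneg (hf.1 x) α)).1 ?_
  exact hf.lintegral_rpow_ne_top hm h1 hα

theorem IsLogConcave.ofReal_integral_rpow (hf : IsLogConcave f) (hm : AEMeasurable f volume)
    (h1 : ∫⁻ x, ENNReal.ofReal (f x) = 1) {α : ℝ} (hα : 0 < α) :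
    ENNReal.ofReal (∫ x, f x ^ α) = ∫⁻ x, ENNReal.ofReal (f x ^ α) :=
  ofReal_integral_eq_lintegral_ofReal (hf.integrable_rpow hm h1 hα)
    (.of_forall fun x => Real.rpow_nonneg (hf.1 x) α)

theorem IsLogConcave.integral_rpow_pos (hf : IsLogConcave f) (hm : AEMeasurable f volume)
    (h1 : ∫⁻ x, ENNReal.ofReal (f x) = 1) {α : ℝ} (hα : 0 < α) : 0 < ∫ x, f x ^ α := by
  have h := lintegral_rpow_ne_zero hm hf.1 h1 α
  rw [← hf.ofReal_integral_rpow hm h1 hα] at h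
  simpa using h

/-- For a log-concave density `f` on `ℝⁿ`, the function `α ↦ n log α + log ∫ f ^ α` is concave. -/
theorem IsLogConcave.concaveOn_log_integral_rpow (hf : IsLogConcave f)
    (hm : AEMeasurable f volume) (h1 : ∫⁻ x, ENNReal.ofReal (f x) = 1) :
    ConcaveOn ℝ (Set.Ioi 0) fun α : ℝ => n * Real.log α + Real.log (∫ x, f x ^ α) := by
  refine concaveOn_iff_forall_pos.2 ⟨convex_Ioi 0, fun α hα β hβ a b ha hb hab => ?_⟩
  have hα0 : 0 < α := hα
  have hβ0 : 0 < β := hβ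
  have hγ0 : 0 < a * α + b * β := by positivity
  have hI : ∀ {γ : ℝ}, 0 < γ → 0 < γ ^ n * ∫ x, f x ^ γ := fun hγ =>
    mul_pos (pow_pos hγ n) (hf.integral_rpow_pos hm h1 hγ)
  have h := hf.lintegral_rpow_logConcave hα0 hβ0 ha hb hab
  rw [← hf.ofReal_integral_rpow hm h1 hα0, ← hf.ofReal_integral_rpow hm h1 hβ0,
    ← hf.ofReal_integral_rpow hm h1 hγ0, ← ENNReal.ofReal_mul (by positivity),
    ← ENNReal.ofReal_mul (by positivity), ← ENNReal.ofReal_mul (by positivity),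
    ENNReal.ofReal_rpow_of_pos (hI hα0), ENNReal.ofReal_rpow_of_pos (hI hβ0),
    ← ENNReal.ofReal_mul (Real.rpow_nonneg (hI hα0).le _),
    ENNReal.ofReal_le_ofReal_iff (hI hγ0).le] at h
  have hp1 := Real.rpow_pos_of_pos (hI hα0) a
  have hp2 := Real.rpow_pos_of_pos (hI hβ0) b
  have hlog : ∀ {γ : ℝ}, 0 < γ → Real.log (γ ^ n * ∫ x, f x ^ γ) =
      n * Real.log γ + Real.log (∫ x, f x ^ γ) := fun {γ} hγ => by
    rw [Real.log_mul (pow_pos hγ n).ne' (hf.integral_rpow_pos hm h1 hγ).ne', Real.log_pow]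
  have := Real.log_le_log (mul_pos hp1 hp2) h
  rw [Real.log_mul hp1.ne' hp2.ne', Real.log_rpow (hI hα0), Real.log_rpow (hI hβ0), hlog hα0,
    hlog hβ0, hlog hγ0] at this
  exact this

/-- From $\log y\le y$ and $-\log y\le 2y^{-1/2}$ follows $|f\log f|\le f^2+2f^{1/2}$. -/
theorem IsLogConcave.integrable_mul_log (hf : IsLogConcave f) (hm : AEMeasurable f volume)
    (h1 : ∫⁻ x, ENNReal.ofReal (f x) = 1) : Integrable fun x => f x * Real.log (f x) := by
  have h2 : (0 : ℝ) < 2 := two_pos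
  have h3 : (0 : ℝ) < 1 / 2 := by norm_num
  refine ((hf.integrable_rpow hm h1 h2).add ((hf.integrable_rpow hm h1 h3).const_mul 2)).mono'
    (hm.mul (Real.measurable_log.comp_aemeasurable hm)).aestronglyMeasurable
    (.of_forall fun x => ?_)
  simp only [Pi.add_apply]
  rcases (hf.1 x).eq_or_lt with h0 | h0
  · simp [← h0]
  rw [Real.norm_eq_abs, abs_mul, abs_of_pos h0]
  have e1 : Real.log (f x) ≤ f x := (Real.log_le_sub_one_of_pos h0).trans (by linarith)
  have e2 : -(2 * f x ^ (-(1 / 2) : ℝ)) ≤ Real.log (f x) := by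
    have := Real.log_le_sub_one_of_pos (Real.rpow_pos_of_pos h0 (-(1 / 2)))
    rw [Real.log_rpow h0] at this
    linarith
  have e3 : |Real.log (f x)| ≤ f x + 2 * f x ^ (-(1 / 2) : ℝ) := by
    have := Real.rpow_pos_of_pos h0 (-(1 / 2))
    rw [abs_le]; constructor <;> linarith
  have e4 : f x * f x ^ (-(1 / 2) : ℝ) = f x ^ (1 / 2 : ℝ) := by
    conv_lhs => rw [← Real.rpow_one (f x), ← Real.rpow_mul h0.le, ← Real.rpow_add h0]
    norm_num
  calc f x * |Real.log (f x)| ≤ f x * (f x + 2 * f x ^ (-(1 / 2) : ℝ)) := by gcongr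
    _ = f x ^ (2 : ℝ) + 2 * (f x * f x ^ (-(1 / 2) : ℝ)) := by rw [Real.rpow_two]; ring
    _ = _ := by rw [e4]

theorem mul_exp_log_eq_rpow {y α : ℝ} (hy : 0 ≤ y) (hα : 0 < α) :
    y * Real.exp ((α - 1) * Real.log y) = y ^ α := by
  rcases hy.eq_or_lt with rfl | hy
  · simp [hα.ne']
  · rw [Real.rpow_def_of_pos hy]
    conv_lhs => rw [← Real.exp_log hy, Real.log_exp, ← Real.exp_add]
    ring_nf

/-- Jensen's inequality: `log ∫ f ^ α ≥ (α - 1) ∫ f log f`. -/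
theorem IsLogConcave.le_log_integral_rpow (hf : IsLogConcave f) (hm : AEMeasurable f volume)
    (h1 : ∫⁻ x, ENNReal.ofReal (f x) = 1) {α : ℝ} (hα : 0 < α) :
    (α - 1) * (∫ x, f x * Real.log (f x)) ≤ Real.log (∫ x, f x ^ α) := by
  set E := ∫ x, f x * Real.log (f x) with hE
  have hint : Integrable f := by
    simpa using hf.integrable_rpow hm h1 one_pos
  have hone : ∫ x, f x = 1 := by
    rw [integral_eq_lintegral_of_nonneg_ae (.of_forall hf.1) hm.aestronglyMeasurable, h1]
    simp
  have hL := hf.integrable_mul_log hm h1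
  rw [Real.le_log_iff_exp_le (hf.integral_rpow_pos hm h1 hα)]
  set C := Real.exp ((α - 1) * E) with hC
  -- The integrand is $f$ times the tangent to $e^s$ at $s=(\alpha-1)E$, evaluated at
  -- $s=(\alpha-1)\log f$; convexity of $\exp$ puts it below $f^\alpha$.
  have hlow : ∫ x, (C * (1 - (α - 1) * E) * f x + C * (α - 1) * (f x * Real.log (f x))) = C := by
    rw [integral_add (hint.const_mul _) (hL.const_mul _), integral_const_mul, integral_const_mul,
      hone, ← hE]
    ring
  rw [← hlow]
  refine integral_mono ((hint.const_mul _).add (hL.const_mul _)) (hf.integrable_rpow hm h1 hα)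
    fun x => ?_
  simp only
  rw [← mul_exp_log_eq_rpow (hf.1 x) hα]
  have h2 := Real.add_one_le_exp ((α - 1) * Real.log (f x) - (α - 1) * E)
  have h3 : Real.exp ((α - 1) * Real.log (f x)) =
      C * Real.exp ((α - 1) * Real.log (f x) - (α - 1) * E) := by
    rw [hC, ← Real.exp_add]; ring_nf
  rw [h3]
  calc _ = f x * (C * ((α - 1) * Real.log (f x) - (α - 1) * E + 1)) := by ring
    _ ≤ _ := by
      have := hf.1 x
      gcongr

/-- The sharp bound on the moments `∫ f ^ α` of a log-concave density in terms of its entropy. -/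
theorem IsLogConcave.integral_rpow_le (hf : IsLogConcave f) (hm : AEMeasurable f volume)
    (h1 : ∫⁻ x, ENNReal.ofReal (f x) = 1) {α : ℝ} (hα : 0 < α) :
    ∫ x, f x ^ α ≤ Real.exp ((α - 1) * ((∫ x, f x * Real.log (f x)) + n) - n * Real.log α) := by
  have hone : ∫ x, f x = 1 := by
    rw [integral_eq_lintegral_of_nonneg_ae (.of_forall hf.1) hm.aestronglyMeasurable, h1]
    simp
  have h := (hf.concaveOn_log_integral_rpow hm h1).le_line_of_lower_bound
    (E := ∫ x, f x * Real.log (f x)) (c := n) (by simp [hone]) (fun γ hγ => ?_) hα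
  · rw [← Real.log_le_iff_le_exp (hf.integral_rpow_pos hm h1 hα)]
    linarith
  -- Jensen together with $\log\gamma\ge1-1/\gamma$ gives the required lower bound.
  · have hJ := hf.le_log_integral_rpow hm h1 hγ
    have hlog := Real.one_sub_inv_le_log_of_pos hγ
    have hn : (n : ℝ) * (1 - γ⁻¹) ≤ n * Real.log γ := by gcongr
    have e : (γ - 1) * ((n : ℝ) / γ) = n * (1 - γ⁻¹) := by field_simp
    rw [mul_add, e]
    linarith

end

/-! ### Exponential moments of the information content and Chernoff bounds -/

section

variable {Ω : Type*} [MeasurableSpace Ω] {P : Measure Ω} {n : ℕ}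
  {X : Ω → EuclideanSpace ℝ (Fin n)} {f : EuclideanSpace ℝ (Fin n) → ℝ}

theorem HasDensity.lintegral_eq_one [IsProbabilityMeasure P] (hX : HasDensity P X f) :
    ∫⁻ x, ENNReal.ofReal (f x) = 1 := by
  have h := hX.hasLaw.map_eq
  have h1 : (P.map X) Set.univ = 1 := by
    rw [Measure.map_apply_of_aemeasurable hX.hasLaw.aemeasurable MeasurableSet.univ]
    simp
  rw [h, withDensity_apply _ MeasurableSet.univ, Measure.restrict_univ] at h1
  exact h1

theorem IsLogConcave.toReal_smul_exp_infoContent (hf : IsLogConcave f) {t : ℝ} (ht : t < 1)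
    (x : EuclideanSpace ℝ (Fin n)) :
    (ENNReal.ofReal (f x)).toReal • Real.exp (t * infoContent f x) = f x ^ (1 - t) := by
  rw [ENNReal.toReal_ofReal (hf.1 x), smul_eq_mul,
    ← mul_exp_log_eq_rpow (hf.1 x) (sub_pos.2 ht), infoContent]
  ring_nf

theorem HasDensity.aemeasurable_exp_infoContent (hX : HasDensity P X f) (t : ℝ) :
    AEMeasurable (fun x => Real.exp (t * infoContent f x))
      (volume.withDensity fun x => ENNReal.ofReal (f x)) := by
  have h : AEMeasurable (fun x => Real.exp (t * infoContent f x)) volume :=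
    ((Real.measurable_log.comp_aemeasurable hX.aemeasurable_density).neg.const_mul t).exp
  exact h.mono_ac (withDensity_absolutelyContinuous _ _)

theorem HasDensity.integrable_exp_infoContent [IsProbabilityMeasure P] (hX : HasDensity P X f)
    (hf : IsLogConcave f) {t : ℝ} (ht : t < 1) :
    Integrable (fun ω => Real.exp (t * infoContent f (X ω))) P := by
  have h : Integrable (fun x => Real.exp (t * infoContent f x)) (P.map X) := by
    rw [hX.hasLaw.map_eq, integrable_withDensity_iff_integrable_smul₀'
      hX.aemeasurable_density.ennreal_ofReal (.of_forall fun _ => ENNReal.ofReal_lt_top)]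
    simp only [hf.toReal_smul_exp_infoContent ht]
    exact hf.integrable_rpow hX.aemeasurable_density hX.lintegral_eq_one (sub_pos.2 ht)
  exact h.comp_aemeasurable hX.hasLaw.aemeasurable

theorem HasDensity.mgf_infoContent (hX : HasDensity P X f) (hf : IsLogConcave f) {t : ℝ}
    (ht : t < 1) : mgf (fun ω => infoContent f (X ω)) P t = ∫ x, f x ^ (1 - t) := by
  have h := hX.hasLaw.integral_comp (f := fun x => Real.exp (t * infoContent f x))
    (hX.aemeasurable_exp_infoContent t).aestronglyMeasurable
  rw [integral_withDensity_eq_integral_toReal_smul₀ hX.aemeasurable_density.ennreal_ofReal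
    (.of_forall fun _ => ENNReal.ofReal_lt_top)] at h
  simp only [hf.toReal_smul_exp_infoContent ht] at h
  exact h

/-- The Chernoff exponent for both tails: $u$ and $t$ are positive for the upper one, negative for
the lower one. -/
theorem HasDensity.exp_mul_mgf_infoContent_le [IsProbabilityMeasure P] (hX : HasDensity P X f)
    (hf : IsLogConcave f) {t : ℝ} (ht : t < 1) (u : ℝ) :
    Real.exp (-t * (entropy f + n * u)) * mgf (fun ω => infoContent f (X ω)) P t ≤
      Real.exp (n * (-t * u + t ^ 2 / (1 - t))) := by
  have ht' : 0 < 1 - t := sub_pos.2 ht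
  rw [hX.mgf_infoContent hf ht]
  refine (mul_le_mul_of_nonneg_left (hf.integral_rpow_le hX.aemeasurable_density
    hX.lintegral_eq_one ht') (Real.exp_pos _).le).trans ?_
  rw [← Real.exp_add, Real.exp_le_exp, entropy]
  have hlog := Real.one_sub_inv_le_log_of_pos ht'
  have hn : (n : ℝ) * (1 - (1 - t)⁻¹) ≤ n * Real.log (1 - t) := by gcongr
  have e : t ^ 2 / (1 - t) = -t - (1 - (1 - t)⁻¹) := by field_simp; ring
  rw [e]
  linarith

theorem HasDensity.measure_infoContent_ge_le [IsProbabilityMeasure P] (hX : HasDensity P X f)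
    (hf : IsLogConcave f) {ε : ℝ} (h0 : 0 ≤ ε) (h2 : ε ≤ 2) :
    P.real {ω | entropy f + n * ε ≤ infoContent f (X ω)} ≤ Real.exp (-(ε ^ 2 * n) / 16) := by
  -- For $t=\varepsilon/4$, the bound $\varepsilon\le2$ gives $1-t\ge1/2$, so the exponent is at
  -- most $-n\varepsilon^2/8$.
  have ht : ε / 4 < 1 := by linarith
  refine (measure_ge_le_exp_mul_mgf _ (by positivity)
    (hX.integrable_exp_infoContent hf ht)).trans
    ((hX.exp_mul_mgf_infoContent_le hf ht ε).trans (Real.exp_le_exp.2 ?_))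
  have h1 : (ε / 4) ^ 2 / (1 - ε / 4) ≤ (ε / 4) ^ 2 * 2 := by
    rw [div_le_iff₀ (by linarith)]
    nlinarith [sq_nonneg (ε / 4)]
  have h3 : -(ε / 4) * ε + (ε / 4) ^ 2 / (1 - ε / 4) ≤ -ε ^ 2 / 16 := by
    nlinarith [sq_nonneg ε]
  calc _ ≤ n * (-ε ^ 2 / 16) := by gcongr
    _ = _ := by ring

theorem HasDensity.measure_infoContent_le_le [IsProbabilityMeasure P] (hX : HasDensity P X f)
    (hf : IsLogConcave f) {ε : ℝ} (h0 : 0 ≤ ε) :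
    P.real {ω | infoContent f (X ω) ≤ entropy f - n * ε} ≤ Real.exp (-(ε ^ 2 * n) / 16) := by
  -- For $t=-\varepsilon/2$ one has $1-t\ge1$, so no upper bound on $\varepsilon$ is needed; the
  -- exponent is at most $-n\varepsilon^2/4$.
  have ht : -(ε / 2) < 1 := by linarith
  have hs : entropy f - n * ε = entropy f + n * -ε := by ring
  rw [hs]
  refine (measure_le_le_exp_mul_mgf _ (by linarith)
    (hX.integrable_exp_infoContent hf ht)).trans
    ((hX.exp_mul_mgf_infoContent_le hf ht (-ε)).trans (Real.exp_le_exp.2 ?_))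
  have h1 : (-(ε / 2)) ^ 2 / (1 - -(ε / 2)) ≤ (-(ε / 2)) ^ 2 :=
    div_le_self (sq_nonneg _) (by linarith)
  have h3 : - -(ε / 2) * -ε + (-(ε / 2)) ^ 2 / (1 - -(ε / 2)) ≤ -ε ^ 2 / 16 := by
    nlinarith [sq_nonneg ε]
  calc _ ≤ n * (-ε ^ 2 / 16) := by gcongr
    _ = _ := by ring

end

/-- The entropy of a log-concave density is finite (so that `entropy f` is a genuine integral), and
the information content per coordinate concentrates around the entropy per coordinate. -/
theorem theorem2 {Ω : Type*} [MeasurableSpace Ω] (P : Measure Ω) [IsProbabilityMeasure P]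
    (n : ℕ) (X : Ω → EuclideanSpace ℝ (Fin n)) (f : EuclideanSpace ℝ (Fin n) → ℝ)
    (hX : HasDensity P X f) (hf : IsLogConcave f) :
    Integrable (fun x => f x * Real.log (f x)) volume ∧
      ∀ ε : ℝ, 0 ≤ ε → ε ≤ 2 →
        P.real {ω | |infoContent f (X ω) / (n : ℝ) - entropy f / (n : ℝ)| ≥ ε} ≤
          4 * Real.exp (-(ε ^ 2 * (n : ℝ)) / 16) := by
  refine ⟨hf.integrable_mul_log hX.aemeasurable_density hX.lintegral_eq_one, fun ε h0 h2 => ?_⟩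
  -- For $n=0$ the right-hand side is $4$, which exceeds any probability.
  rcases Nat.eq_zero_or_pos n with rfl | hn
  · refine measureReal_le_one.trans ?_
    norm_num
  have hn' : (0 : ℝ) < n := by exact_mod_cast hn
  have hsub : {ω | |infoContent f (X ω) / (n : ℝ) - entropy f / (n : ℝ)| ≥ ε} ⊆
      {ω | entropy f + n * ε ≤ infoContent f (X ω)} ∪
        {ω | infoContent f (X ω) ≤ entropy f - n * ε} := by
    intro ω (hω : ε ≤ |infoContent f (X ω) / (n : ℝ) - entropy f / (n : ℝ)|)
    rw [← sub_div, le_abs, ← neg_div, le_div_iff₀ hn', le_div_iff₀ hn'] at hω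
    rcases hω with hω | hω
    · left
      simp only [Set.mem_ofPred_eq]
      linarith
    · right
      simp only [Set.mem_ofPred_eq]
      linarith
  -- The two tails add up to the constant $2$, within the claimed $4$.
  have h3 := (measureReal_mono (μ := P) hsub).trans (measureReal_union_le _ _)
  have h4 := hX.measure_infoContent_ge_le hf h0 h2
  have h5 := hX.measure_infoContent_le_le hf h0
  have h6 := Real.exp_pos (-(ε ^ 2 * (n : ℝ)) / 16)
  linarith
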